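/- Let $q>0$ be a real number that is not an even integer, let $n\ge 1$, and let $X=(\mathbb R^n,\|\cdot\|)$ be an $n$-dimensional real Banach space. Let $S_n$ be the Euclidean unit sphere of $\mathbb R^n$, $d\xi$ its surface measure and $(x,\xi)$ the standard scalar product, and suppose that there is a continuous function $b:S_n\to\mathbb R$ such that, for every $x\in\mathbb R^n$, $$\|x\|^q=\int_{S_n}|(x,\xi)|^q\,b(\xi)\,d\xi .$$ Say that $X$ is isometric to a subspace of $L_q$ if there is a linear map $T:X\to L_q([0,1])$ with $\|Tx\|_q=\|x\|$ for all $x$, where $\|f\|_q=\left(\int_0^1|f(t)|^q\,dt\right)^{1/q}$. If $b$ is non-negative and not identically zero, then $X$ is isometric to a subspace of $L_q$. If $b$ is even, i.e. $b(-\xi)=b(\xi)$ for all $\xi\in S_n$ (and of arbitrary sign), then $X$ is isometric to a subspace of $L_q$ if and only if $b$ is non-negative and not identically zero. -/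

import Mathlib

open MeasureTheory Metric

/-- A real normed space `X` is isometric to a (linear) subspace of `L_q = L_q([0,1])` (real-valued
functions, Lebesgue measure): there is a linear map `T : X → L_q` preserving the norm, where
`‖f‖ = (∫ |f|^q)^(1/q)` on `L_q`, which is only a quasi-norm when `q < 1`.
Such a map is automatically injective, and its range is the subspace. -/
def IsometricToSubspaceOfLq (X : Type*) [NormedAddCommGroup X] [NormedSpace ℝ X] (q : ℝ) : Prop :=
  ∃ T : X →ₗ[ℝ] Lp ℝ (ENNReal.ofReal q) (volume : Measure unitInterval), ∀ x : X, ‖T x‖ = ‖x‖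

/-! The heart is uniqueness: for `q` not an even integer, the integrals of `|⟪x, ξ⟫| ^ q` determine
a finite measure on the sphere up to its odd part. Averaging over `x = g + y`, with `g` standard
Gaussian, replaces `|⟪y, ξ⟫| ^ q` by `h ⟪y, ξ⟫`, where `h s = E |Z + s| ^ q` is smooth and satisfies
`h'' = q h - s h'`. Hence `h⁽²ᵏ⁺²⁾(0) = (q - 2k) h⁽²ᵏ⁾(0)`, and no even derivative vanishes at `0`.
Differentiating along `t y` at `t = 0` therefore recovers all even moments of `⟪y, ξ⟫`, so the
integrals of `cos ⟪y, ξ⟫`, so the characteristic function of the symmetrised measure.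

An embedding into `L_q` yields a positive representing measure `m` on the sphere. For even `b`,
uniqueness forces `b⁺σ` and `m + b⁻σ` to agree on the symmetric open set `{b < 0}`, which must then
be empty. Conversely, a nonzero positive representing measure is, up to scale, an image of Lebesgue
measure on `[0,1]`, which gives the embedding. -/

open ProbabilityTheory Real
open scoped ContDiff RealInnerProductSpace

/-! ### Gaussian smoothing of the power function -/

/-- The mean of `|Z + s| ^ q` for a standard Gaussian `Z`. -/
noncomputable def gaussianAbsMoment (q s : ℝ) : ℝ := ∫ z, |z + s| ^ q ∂(gaussianReal 0 1)

/-- The measure with density `|z| ^ q` with respect to the standard Gaussian. -/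
noncomputable def absRpowGaussian (q : ℝ) : Measure ℝ :=
  (gaussianReal 0 1).withDensity fun z ↦ ENNReal.ofReal (|z| ^ q)

lemma integral_absRpowGaussian (q : ℝ) (f : ℝ → ℝ) :
    ∫ z, f z ∂(absRpowGaussian q) = ∫ z, |z| ^ q * f z ∂(gaussianReal 0 1) := by
  rw [absRpowGaussian, integral_withDensity_eq_integral_toReal_smul (by fun_prop) (by simp)]
  refine integral_congr_ae (ae_of_all _ fun z ↦ ?_)
  simp [ENNReal.toReal_ofReal (rpow_nonneg (abs_nonneg z) q)]

lemma integrable_absRpowGaussian_iff (q : ℝ) (f : ℝ → ℝ) :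
    Integrable f (absRpowGaussian q) ↔
      Integrable (fun z ↦ |z| ^ q * f z) (gaussianReal 0 1) := by
  rw [absRpowGaussian, integrable_withDensity_iff_integrable_smul' (by fun_prop) (by simp)]
  refine integrable_congr (ae_of_all _ fun z ↦ ?_)
  simp [ENNReal.toReal_ofReal (rpow_nonneg (abs_nonneg z) q)]

lemma integrable_abs_rpow_mul_exp_gaussianReal {q : ℝ} (hq : 0 ≤ q) (s : ℝ) :
    Integrable (fun z ↦ |z| ^ q * exp (s * z)) (gaussianReal 0 1) :=
  integrable_rpow_abs_mul_exp_of_mem_interior_integrableExpSet (X := id)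
    (by simp [integrableExpSet_id_gaussianReal]) hq

lemma integrableExpSet_absRpowGaussian {q : ℝ} (hq : 0 ≤ q) :
    integrableExpSet id (absRpowGaussian q) = Set.univ := by
  refine Set.eq_univ_of_forall fun s ↦ ?_
  simpa [integrableExpSet, integrable_absRpowGaussian_iff] using
    integrable_abs_rpow_mul_exp_gaussianReal hq s

lemma integrable_pow_mul_exp_absRpowGaussian {q : ℝ} (hq : 0 ≤ q) (s : ℝ) (k : ℕ) :
    Integrable (fun z ↦ |z| ^ q * (z ^ k * exp (s * z))) (gaussianReal 0 1) :=
  (integrable_absRpowGaussian_iff q _).1 <|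
    integrable_pow_mul_exp_of_mem_interior_integrableExpSet (X := id)
      (by simp [integrableExpSet_absRpowGaussian hq]) k

lemma hasDerivAt_mul_abs_rpow {q : ℝ} (hq : 0 < q) (x : ℝ) :
    HasDerivAt (fun z : ℝ ↦ z * |z| ^ q) ((q + 1) * |x| ^ q) x := by
  have hne (x : ℝ) (hx : x ≠ 0) :
      HasDerivAt (fun z : ℝ ↦ z * |z| ^ q) ((q + 1) * |x| ^ q) x := by
    have h := (hasDerivAt_id x).mul
      ((hasDerivAt_abs hx).rpow_const (p := q) (Or.inl (abs_ne_zero.2 hx)))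
    refine h.congr_deriv ?_
    have h1 : |x| ^ q = |x| ^ (q - 1) * |x| := by
      rw [← rpow_add_one (abs_ne_zero.2 hx)]; simp
    have h2 : x * (SignType.sign x : ℝ) = |x| := by
      rw [mul_comm]; exact sign_mul_self x
    simp only [id]
    rw [h1, ← h2]
    ring
  have hc : Continuous fun z : ℝ ↦ |z| ^ q := continuous_abs.rpow_const fun _ ↦ Or.inr hq.le
  rcases eq_or_ne x 0 with rfl | hx
  -- At `0` the derivative is the limit of the derivatives nearby.
  · exact hasDerivAt_of_hasDerivAt_of_ne' (g := fun x ↦ (q + 1) * |x| ^ q) hne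
      (by fun_prop) (hc.const_mul _).continuousAt 0
  · exact hne x hx

/-- The derivative of `z |z| ^ q exp (s z)` times the Gaussian density integrates to zero. The
factor `z` keeps this function differentiable at `0` even for `q < 1`. -/
lemma integral_gaussian_by_parts {q : ℝ} (hq : 0 < q) (s : ℝ) :
    ∫ z, |z| ^ q * (z ^ 2 * exp (s * z)) ∂(gaussianReal 0 1) =
      s * ∫ z, |z| ^ q * (z ^ 1 * exp (s * z)) ∂(gaussianReal 0 1) +
        (q + 1) * ∫ z, |z| ^ q * exp (s * z) ∂(gaussianReal 0 1) := by
  have i0 := integrable_abs_rpow_mul_exp_gaussianReal hq.le s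
  have i1 := integrable_pow_mul_exp_absRpowGaussian hq.le s 1
  have i2 := integrable_pow_mul_exp_absRpowGaussian hq.le s 2
  have key : ∫ z, ((s * (|z| ^ q * (z ^ 1 * exp (s * z))) + (q + 1) * (|z| ^ q * exp (s * z)))
      - |z| ^ q * (z ^ 2 * exp (s * z))) ∂(gaussianReal 0 1) = 0 := by
    rw [integral_gaussianReal_eq_integral_smul one_ne_zero]
    refine integral_eq_zero_of_hasDerivAt_of_integrable
      (f := fun z ↦ gaussianPDFReal 0 1 z • (|z| ^ q * (z ^ 1 * exp (s * z)))) ?_ ?_ ?_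
    · intro z
      have hp : HasDerivAt (gaussianPDFReal 0 1) (-z * gaussianPDFReal 0 1 z) z := by
        rw [gaussianPDFReal_def]
        have := ((((hasDerivAt_id z).sub_const 0).pow 2).neg.div_const
          (2 * ((1 : NNReal) : ℝ))).exp.const_mul ((√(2 * π * ((1 : NNReal) : ℝ)))⁻¹)
        refine this.congr_deriv ?_
        simp
        ring
      have he : HasDerivAt (fun z ↦ exp (s * z)) (exp (s * z) * s) z := by
        simpa using ((hasDerivAt_id z).const_mul s).exp
      have := hp.mul ((hasDerivAt_mul_abs_rpow hq z).mul he)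
      refine (this.congr_deriv ?_).congr_of_eventuallyEq (.of_forall fun z ↦ ?_)
      · simp only [smul_eq_mul, Pi.mul_apply]; ring
      · simp only [smul_eq_mul, Pi.mul_apply]; ring
    · have := ((i1.const_mul s).add (i0.const_mul (q + 1))).sub i2
      rw [gaussianReal_of_var_ne_zero _ one_ne_zero,
        integrable_withDensity_iff_integrable_smul' (by fun_prop)
          (ae_of_all _ fun _ ↦ gaussianPDF_lt_top)] at this
      simpa [toReal_gaussianPDF] using this
    · have := i1
      rw [gaussianReal_of_var_ne_zero _ one_ne_zero,
        integrable_withDensity_iff_integrable_smul' (by fun_prop)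
          (ae_of_all _ fun _ ↦ gaussianPDF_lt_top)] at this
      simpa [toReal_gaussianPDF] using this
  rw [integral_sub (by exact (i1.const_mul s).add (i0.const_mul (q + 1))) i2,
    integral_add (i1.const_mul s) (i0.const_mul (q + 1)), integral_const_mul,
    integral_const_mul] at key
  linarith

/-- Completing the square moves the shift `s` from the power into an exponential weight, so
smoothness in `s` follows from analyticity of the mgf. -/
lemma gaussianAbsMoment_eq (q s : ℝ) :
    gaussianAbsMoment q s = exp (-(s ^ 2) / 2) * mgf id (absRpowGaussian q) s := by
  have h1 : gaussianAbsMoment q s = ∫ z, |z| ^ q ∂(gaussianReal s 1) := by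
    have := gaussianReal_map_add_const (μ := 0) (v := 1) s
    rw [zero_add] at this
    rw [← this, integral_map (by fun_prop)
      (by fun_prop : Measurable fun z : ℝ ↦ |z| ^ q).aestronglyMeasurable, gaussianAbsMoment]
  rw [h1, mgf, integral_absRpowGaussian, ← integral_const_mul,
    integral_gaussianReal_eq_integral_smul one_ne_zero,
    integral_gaussianReal_eq_integral_smul one_ne_zero]
  congr 1 with z
  have : exp (-(z - s) ^ 2 / 2) = exp (-(s ^ 2) / 2) * exp (s * z) * exp (-z ^ 2 / 2) := by
    rw [← exp_add, ← exp_add]; congr 1; ring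
  simp only [gaussianPDFReal_def, NNReal.coe_one, mul_one, sub_zero, this, smul_eq_mul, id]
  ring

lemma contDiff_mgf_absRpowGaussian {q : ℝ} (hq : 0 ≤ q) :
    ContDiff ℝ ∞ (mgf id (absRpowGaussian q)) := by
  rw [contDiff_iff_contDiffAt]
  intro s
  exact (analyticAt_mgf (by simp [integrableExpSet_absRpowGaussian hq])).contDiffAt

lemma contDiff_gaussianAbsMoment {q : ℝ} (hq : 0 ≤ q) :
    ContDiff ℝ ∞ (gaussianAbsMoment q) := by
  have h1 : gaussianAbsMoment q = fun s ↦ exp (-(s ^ 2) / 2) * mgf id (absRpowGaussian q) s :=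
    funext fun s ↦ gaussianAbsMoment_eq q s
  have := contDiff_mgf_absRpowGaussian hq
  rw [h1]
  fun_prop

lemma hasDerivAt_iteratedDeriv_gaussianAbsMoment {q : ℝ} (hq : 0 ≤ q) (k : ℕ) (s : ℝ) :
    HasDerivAt (iteratedDeriv k (gaussianAbsMoment q))
      (iteratedDeriv (k + 1) (gaussianAbsMoment q) s) s := by
  rw [iteratedDeriv_succ]
  exact ((contDiff_gaussianAbsMoment hq).differentiable_iteratedDeriv k
    (by exact_mod_cast WithTop.coe_lt_top _)).differentiableAt.hasDerivAt

/-- The case `k = 0` is the equation `h'' = q h - s h'`, which is integration by parts;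
differentiating it gives the rest. -/
lemma iteratedDeriv_gaussianAbsMoment_add_two {q : ℝ} (hq : 0 < q) (k : ℕ) (s : ℝ) :
    iteratedDeriv (k + 2) (gaussianAbsMoment q) s =
      (q - k) * iteratedDeriv k (gaussianAbsMoment q) s -
        s * iteratedDeriv (k + 1) (gaussianAbsMoment q) s := by
  have hI (s : ℝ) : s ∈ interior (integrableExpSet id (absRpowGaussian q)) := by
    simp [integrableExpSet_absRpowGaussian hq.le]
  induction k generalizing s with
  | zero =>
    set M := mgf id (absRpowGaussian q)
    have hM (s : ℝ) : HasDerivAt M (iteratedDeriv 1 M s) s := by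
      rw [iteratedDeriv_mgf (hI s) 1]
      simpa using! hasDerivAt_iteratedDeriv_mgf (hI s) 0
    have hM' (s : ℝ) : HasDerivAt (iteratedDeriv 1 M) (iteratedDeriv 2 M s) s := by
      rw [iteratedDeriv_mgf (hI s) 2]
      exact hasDerivAt_iteratedDeriv_mgf (hI s) 1
    have hM2 : iteratedDeriv 2 M s = s * iteratedDeriv 1 M s + (q + 1) * M s := by
      rw [iteratedDeriv_mgf (hI s) 2, iteratedDeriv_mgf (hI s) 1, integral_absRpowGaussian,
        integral_absRpowGaussian]
      have : M s = ∫ z, |z| ^ q * exp (s * z) ∂(gaussianReal 0 1) := by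
        rw [← integral_absRpowGaussian]; rfl
      rw [this]
      exact integral_gaussian_by_parts hq s
    have he (s : ℝ) : HasDerivAt (fun s : ℝ ↦ exp (-(s ^ 2) / 2)) (-s * exp (-(s ^ 2) / 2)) s := by
      refine ((((hasDerivAt_id s).pow 2).neg.div_const 2).exp).congr_deriv ?_
      simp; ring
    have h0 : gaussianAbsMoment q = fun s ↦ exp (-(s ^ 2) / 2) * M s :=
      funext fun s ↦ gaussianAbsMoment_eq q s
    have h1 : iteratedDeriv 1 (gaussianAbsMoment q) =
        fun s ↦ exp (-(s ^ 2) / 2) * (iteratedDeriv 1 M s - s * M s) := by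
      rw [iteratedDeriv_one]
      ext s
      rw [h0]
      refine (((he s).mul (hM s)).congr_deriv ?_).deriv
      ring
    have h2 : iteratedDeriv 2 (gaussianAbsMoment q) s =
        -s * exp (-(s ^ 2) / 2) * (iteratedDeriv 1 M s - s * M s) +
          exp (-(s ^ 2) / 2) * (iteratedDeriv 2 M s - (M s + s * iteratedDeriv 1 M s)) := by
      rw [iteratedDeriv_succ, h1]
      refine (((he s).mul ((hM' s).sub ((hasDerivAt_id s).mul (hM s)))).congr_deriv ?_).deriv
      simp
    rw [zero_add, zero_add, h2, h1, hM2, iteratedDeriv_zero, gaussianAbsMoment_eq]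
    push_cast
    ring
  | succ k ih =>
    have hd := hasDerivAt_iteratedDeriv_gaussianAbsMoment hq.le
    have h := (hd (k + 2) s).unique <|
      (((hd k s).const_mul (q - k)).sub
        ((hasDerivAt_id s).mul (hd (k + 1) s))).congr_of_eventuallyEq
        (.of_forall fun s ↦ by simpa using ih s)
    rw [show k + 1 + 2 = k + 2 + 1 by ring, h]
    push_cast
    simp
    ring

lemma gaussianAbsMoment_zero_pos {q : ℝ} (hq : 0 ≤ q) : 0 < gaussianAbsMoment q 0 := by
  have hi := integrable_abs_rpow_mul_exp_gaussianReal hq 0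
  simp only [zero_mul, exp_zero, mul_one] at hi
  simp only [gaussianAbsMoment, add_zero]
  rw [integral_pos_iff_support_of_nonneg (fun z ↦ by positivity) hi]
  have hs : ({0}ᶜ : Set ℝ) ⊆ Function.support fun z : ℝ ↦ |z| ^ q := fun z hz ↦
    (rpow_pos_of_pos (abs_pos.2 hz) q).ne'
  refine lt_of_lt_of_le ?_ (measure_mono hs)
  have := nullSingletonClass_gaussianReal (μ := 0) (v := 1) one_ne_zero
  rw [prob_compl_eq_one_sub (measurableSet_singleton 0)]
  simp

lemma iteratedDeriv_gaussianAbsMoment_zero_ne_zero {q : ℝ} (hq : 0 < q)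
    (hq_even : ∀ m : ℤ, Even m → q ≠ (m : ℝ)) (k : ℕ) :
    iteratedDeriv (2 * k) (gaussianAbsMoment q) 0 ≠ 0 := by
  induction k with
  | zero => simpa using (gaussianAbsMoment_zero_pos hq.le).ne'
  | succ k ih =>
    rw [mul_add, mul_one, iteratedDeriv_gaussianAbsMoment_add_two hq]
    simp only [zero_mul, sub_zero]
    refine mul_ne_zero (sub_ne_zero.2 ?_) ih
    simpa using hq_even (2 * k) (even_two_mul _)

/-! ### Moments from integrals of a smooth function on a compact space -/

section CompactSpace

variable {K : Type*} [TopologicalSpace K] [CompactSpace K] [MeasurableSpace K]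
  [OpensMeasurableSpace K]

lemma Continuous.integrable_of_compactSpace {m : Measure K} [IsFiniteMeasure m]
    {f : K → ℝ} (hf : Continuous f) : Integrable f m :=
  hf.integrable_of_hasCompactSupport (HasCompactSupport.of_compactSpace f)

lemma hasDerivAt_integral_mul_comp_mul {m : Measure K} [IsFiniteMeasure m] {u w : K → ℝ}
    (hu : Continuous u) (hw : Continuous w) {g g' : ℝ → ℝ} (hg : ∀ s, HasDerivAt g (g' s) s)
    (hg' : Continuous g') (t : ℝ) :
    HasDerivAt (fun t ↦ ∫ ξ, w ξ * g (t * u ξ) ∂m) (∫ ξ, w ξ * u ξ * g' (t * u ξ) ∂m) t := by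
  have hgc : Continuous g := continuous_iff_continuousAt.2 fun s ↦ (hg s).continuousAt
  obtain ⟨C, hC⟩ := ((isCompact_closedBall t 1).prod
    (isCompact_univ (X := K))).exists_bound_of_continuousOn
    (f := fun p : ℝ × K ↦ w p.2 * u p.2 * g' (p.1 * u p.2)) (by fun_prop)
  refine (hasDerivAt_integral_of_dominated_loc_of_deriv_le (bound := fun _ ↦ C)
    (F' := fun t ξ ↦ w ξ * u ξ * g' (t * u ξ)) (closedBall_mem_nhds t one_pos)
    (.of_forall fun s ↦ ?_) ?_ ?_ ?_ (integrable_const C) ?_).2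
  · exact (Continuous.integrable_of_compactSpace (by fun_prop)).aestronglyMeasurable
  · exact Continuous.integrable_of_compactSpace (by fun_prop)
  · exact (Continuous.integrable_of_compactSpace (by fun_prop)).aestronglyMeasurable
  · exact ae_of_all _ fun ξ s hs ↦ hC (s, ξ) ⟨hs, Set.mem_univ ξ⟩
  · refine ae_of_all _ fun ξ s _ ↦ ?_
    have := ((hg (s * u ξ)).comp s ((hasDerivAt_id s).mul_const (u ξ))).const_mul (w ξ)
    refine this.congr_deriv ?_
    ring

variable {m m' : Measure K} [IsFiniteMeasure m] [IsFiniteMeasure m'] {u : K → ℝ}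

/-- Differentiate the assumed identity `k` times in `t` under the integral; at `t = 0` only the
`k`-th moment is left, times a constant. -/
lemma integral_pow_mul_iteratedDeriv_eq (hu : Continuous u) {h : ℝ → ℝ} (hh : ContDiff ℝ ∞ h)
    (heq : ∀ t : ℝ, ∫ ξ, h (t * u ξ) ∂m = ∫ ξ, h (t * u ξ) ∂m') (k : ℕ) (t : ℝ) :
    ∫ ξ, u ξ ^ k * iteratedDeriv k h (t * u ξ) ∂m =
      ∫ ξ, u ξ ^ k * iteratedDeriv k h (t * u ξ) ∂m' := by
  induction k generalizing t with
  | zero => simpa using heq t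
  | succ k ih =>
    have hd (s : ℝ) : HasDerivAt (iteratedDeriv k h) (iteratedDeriv (k + 1) h s) s := by
      rw [iteratedDeriv_succ]
      exact (hh.differentiable_iteratedDeriv k
        (by exact_mod_cast WithTop.coe_lt_top _)).differentiableAt.hasDerivAt
    have hc : Continuous (iteratedDeriv (k + 1) h) :=
      hh.continuous_iteratedDeriv (k + 1) (by exact_mod_cast le_top)
    have h1 := hasDerivAt_integral_mul_comp_mul (m := m) hu (hu.pow k) hd hc t
    have h2 := hasDerivAt_integral_mul_comp_mul (m := m') hu (hu.pow k) hd hc t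
    simpa [pow_succ] using h1.unique (h2.congr_of_eventuallyEq (.of_forall ih))

lemma integral_pow_eq_of_iteratedDeriv_ne_zero (hu : Continuous u) {h : ℝ → ℝ}
    (hh : ContDiff ℝ ∞ h) (heq : ∀ t : ℝ, ∫ ξ, h (t * u ξ) ∂m = ∫ ξ, h (t * u ξ) ∂m')
    {k : ℕ} (hk : iteratedDeriv k h 0 ≠ 0) : ∫ ξ, u ξ ^ k ∂m = ∫ ξ, u ξ ^ k ∂m' := by
  have := integral_pow_mul_iteratedDeriv_eq hu hh heq k 0
  simp only [zero_mul, integral_mul_const] at this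
  exact mul_right_cancel₀ hk this

lemma hasSum_integral_cos (m : Measure K) [IsFiniteMeasure m] (hu : Continuous u) :
    HasSum (fun k : ℕ ↦ (-1) ^ k / (2 * k).factorial * ∫ ξ, u ξ ^ (2 * k) ∂m)
      (∫ ξ, cos (u ξ) ∂m) := by
  obtain ⟨C, hC⟩ := (isCompact_univ (X := K)).exists_bound_of_continuousOn hu.continuousOn
  simp_rw [← integral_const_mul]
  refine hasSum_integral_of_dominated_convergence
    (fun k _ ↦ C ^ (2 * k) / (2 * k).factorial) (fun k ↦ ?_) (fun k ↦ ae_of_all _ fun ξ ↦ ?_)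
    (ae_of_all _ fun _ ↦ (Real.hasSum_cosh C).summable) (integrable_const _)
    (ae_of_all _ fun ξ ↦ ?_)
  · exact (Continuous.integrable_of_compactSpace (by fun_prop)).aestronglyMeasurable
  · rw [norm_mul, norm_div, norm_pow, norm_pow, norm_neg, norm_one, one_pow, one_div, mul_comm,
      ← div_eq_mul_inv, RCLike.norm_natCast]
    gcongr
    exact hC ξ (Set.mem_univ ξ)
  · simpa only [div_mul_eq_mul_div] using Real.hasSum_cos (u ξ)

end CompactSpace

/-! ### Uniqueness of the representing measure on the sphere -/

section Sphere

variable {E : Type*} [NormedAddCommGroup E] [InnerProductSpace ℝ E] [FiniteDimensional ℝ E]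
  [MeasurableSpace E] [BorelSpace E]

lemma map_inner_stdGaussian {ξ : E} (hξ : ‖ξ‖ = 1) :
    (stdGaussian E).map (fun g ↦ ⟪ξ, g⟫) = gaussianReal 0 1 := by
  have h := IsGaussian.map_eq_gaussianReal (μ := stdGaussian E) (innerSL ℝ ξ)
  rw [integral_strongDual_stdGaussian, variance_dual_stdGaussian, innerSL_apply_norm, hξ] at h
  simpa using! h

lemma lintegral_abs_inner_add_rpow_stdGaussian {q : ℝ} (hq : 0 ≤ q) (y : E) {ξ : E}
    (hξ : ‖ξ‖ = 1) :
    ∫⁻ g, ENNReal.ofReal (|⟪g + y, ξ⟫| ^ q) ∂(stdGaussian E) =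
      ENNReal.ofReal (gaussianAbsMoment q ⟪y, ξ⟫) := by
  have hmap : (gaussianReal 0 1).map (· + ⟪y, ξ⟫) = gaussianReal ⟪y, ξ⟫ 1 := by
    simpa using gaussianReal_map_add_const (μ := 0) (v := 1) ⟪y, ξ⟫
  have hi : Integrable (fun z ↦ |z + ⟪y, ξ⟫| ^ q) (gaussianReal 0 1) := by
    have : Integrable (fun z ↦ |z| ^ q) (gaussianReal ⟪y, ξ⟫ 1) :=
      integrable_rpow_abs_of_mem_interior_integrableExpSet (X := id)
        (by simp [integrableExpSet_id_gaussianReal]) hq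
    rw [← hmap] at this
    exact this.comp_measurable (by fun_prop)
  rw [gaussianAbsMoment, ofReal_integral_eq_lintegral_ofReal hi (ae_of_all _ fun z ↦ by positivity),
    ← map_inner_stdGaussian hξ, lintegral_map (by fun_prop) (by fun_prop)]
  simp [inner_add_left, real_inner_comm]

/-- By Tonelli, the left side depends on `m` only through the integrals of `|⟪x, ξ⟫| ^ q`. -/
lemma integral_gaussianAbsMoment_inner {q : ℝ} (hq : 0 < q) (m : Measure (sphere (0 : E) 1))
    [IsFiniteMeasure m] (y : E) :
    ∫ ξ, gaussianAbsMoment q ⟪y, (ξ : E)⟫ ∂m =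
      (∫⁻ g, ENNReal.ofReal (∫ ξ, |⟪g + y, (ξ : E)⟫| ^ q ∂m) ∂(stdGaussian E)).toReal := by
  have hc := (contDiff_gaussianAbsMoment hq.le).continuous
  rw [integral_eq_lintegral_of_nonneg_ae
    (ae_of_all _ fun ξ ↦ by unfold gaussianAbsMoment; positivity)
    (Continuous.integrable_of_compactSpace (by fun_prop)).aestronglyMeasurable]
  congr 1
  have h1 (ξ : sphere (0 : E) 1) := lintegral_abs_inner_add_rpow_stdGaussian hq.le y
    (norm_eq_of_mem_sphere ξ)
  simp_rw [← h1]
  rw [lintegral_lintegral_swap (by fun_prop)]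
  refine lintegral_congr fun g ↦ ?_
  rw [ofReal_integral_eq_lintegral_ofReal _ (ae_of_all _ fun z ↦ by positivity)]
  refine Continuous.integrable_of_compactSpace ?_
  exact Continuous.rpow_const (by fun_prop) fun _ ↦ Or.inr hq.le

variable {m m' : Measure (sphere (0 : E) 1)} [IsFiniteMeasure m] [IsFiniteMeasure m']

lemma integral_cos_inner_eq_of_integral_abs_inner_rpow_eq {q : ℝ} (hq : 0 < q)
    (hq_even : ∀ k : ℤ, Even k → q ≠ (k : ℝ))
    (h : ∀ x : E, ∫ ξ, |⟪x, (ξ : E)⟫| ^ q ∂m = ∫ ξ, |⟪x, (ξ : E)⟫| ^ q ∂m') (y : E) :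
    ∫ ξ, cos ⟪y, (ξ : E)⟫ ∂m = ∫ ξ, cos ⟪y, (ξ : E)⟫ ∂m' := by
  have hu : Continuous fun ξ : sphere (0 : E) 1 ↦ ⟪y, (ξ : E)⟫ := by fun_prop
  have heq (t : ℝ) : ∫ ξ, gaussianAbsMoment q (t * ⟪y, (ξ : E)⟫) ∂m =
      ∫ ξ, gaussianAbsMoment q (t * ⟪y, (ξ : E)⟫) ∂m' := by
    simp_rw [← real_inner_smul_left, integral_gaussianAbsMoment_inner hq, h]
  refine (hasSum_integral_cos m hu).unique ?_
  convert! hasSum_integral_cos m' hu using 3 with k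
  exact integral_pow_eq_of_iteratedDeriv_ne_zero hu (contDiff_gaussianAbsMoment hq.le) heq
    (iteratedDeriv_gaussianAbsMoment_zero_ne_zero hq hq_even k)

/-- Adding the reflected measure cancels the sine part. -/
lemma charFun_map_add_map_neg (m : Measure (sphere (0 : E) 1))
    [IsFiniteMeasure m] (y : E) :
    charFun (m.map (fun ξ : sphere (0 : E) 1 ↦ (ξ : E)) +
        m.map (fun ξ : sphere (0 : E) 1 ↦ -(ξ : E))) y =
      ((∫ ξ, 2 * cos ⟪y, (ξ : E)⟫ ∂m : ℝ) : ℂ) := by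
  have hi {f : sphere (0 : E) 1 → E} (hf : Measurable f) :
      Integrable (fun x ↦ Complex.exp (⟪x, y⟫ * Complex.I)) (m.map f) := by
    have := Measure.isFiniteMeasure_map m f
    refine Integrable.of_bound (C := 1) (by fun_prop) (ae_of_all _ fun x ↦ ?_)
    simp [Complex.norm_exp_ofReal_mul_I]
  have h1 : Measurable fun ξ : sphere (0 : E) 1 ↦ (ξ : E) := by fun_prop
  have h2 : Measurable fun ξ : sphere (0 : E) 1 ↦ -(ξ : E) := by fun_prop
  rw [charFun_apply, integral_add_measure (hi h1) (hi h2),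
    integral_map h1.aemeasurable (by fun_prop), integral_map h2.aemeasurable (by fun_prop),
    ← integral_add (by exact (hi h1).comp_measurable h1) (by exact (hi h2).comp_measurable h2),
    ← integral_complex_ofReal]
  refine integral_congr_ae (ae_of_all _ fun ξ ↦ ?_)
  simp only [inner_neg_right, Complex.ofReal_mul, Complex.ofReal_cos, Complex.cos,
    real_inner_comm y, Complex.ofReal_neg, Complex.ofReal_ofNat]
  ring

/-- If `q` is not an even integer, a finite measure on the sphere is determined on symmetric sets
by the integrals of `|⟪x, ·⟫| ^ q`. -/
theorem measure_eq_of_integral_abs_inner_rpow_eq {q : ℝ} (hq : 0 < q)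
    (hq_even : ∀ k : ℤ, Even k → q ≠ (k : ℝ))
    (h : ∀ x : E, ∫ ξ, |⟪x, (ξ : E)⟫| ^ q ∂m = ∫ ξ, |⟪x, (ξ : E)⟫| ^ q ∂m')
    {U : Set (sphere (0 : E) 1)} (hU : MeasurableSet U) (hsymm : ∀ ξ, -ξ ∈ U ↔ ξ ∈ U) :
    m U = m' U := by
  have h1 : Measurable fun ξ : sphere (0 : E) 1 ↦ (ξ : E) := by fun_prop
  have h2 : Measurable fun ξ : sphere (0 : E) 1 ↦ -(ξ : E) := by fun_prop
  have hS : m.map (fun ξ : sphere (0 : E) 1 ↦ (ξ : E)) +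
        m.map (fun ξ : sphere (0 : E) 1 ↦ -(ξ : E)) =
      m'.map (fun ξ : sphere (0 : E) 1 ↦ (ξ : E)) +
        m'.map (fun ξ : sphere (0 : E) 1 ↦ -(ξ : E)) := by
    refine Measure.ext_of_charFun (funext fun y ↦ ?_)
    rw [charFun_map_add_map_neg, charFun_map_add_map_neg, integral_const_mul, integral_const_mul,
      integral_cos_inner_eq_of_integral_abs_inner_rpow_eq hq hq_even h]
  have hA : MeasurableSet ((↑) '' U : Set E) :=
    (MeasurableEmbedding.subtype_coe isClosed_sphere.measurableSet).measurableSet_image.2 hU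
  have e1 : (fun ξ : sphere (0 : E) 1 ↦ (ξ : E)) ⁻¹' ((↑) '' U) = U :=
    Set.preimage_image_eq _ Subtype.val_injective
  have e2 : (fun ξ : sphere (0 : E) 1 ↦ -(ξ : E)) ⁻¹' ((↑) '' U) = U := by
    ext ξ
    rw [← hsymm ξ]
    exact ⟨fun ⟨η, hη, h⟩ ↦ (Subtype.ext h : η = -ξ) ▸ hη, fun h ↦ ⟨-ξ, h, rfl⟩⟩
  -- A symmetric set gets the same mass from the measure and its reflection.
  have hm (μ : Measure (sphere (0 : E) 1)) :
      (μ.map (fun ξ : sphere (0 : E) 1 ↦ (ξ : E)) +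
        μ.map (fun ξ : sphere (0 : E) 1 ↦ -(ξ : E))) ((↑) '' U) = 2 * μ U := by
    rw [Measure.add_apply, Measure.map_apply h1 hA, Measure.map_apply h2 hA, e1, e2, two_mul]
  have := congrArg (fun ν : Measure E ↦ ν ((↑) '' U)) hS
  simp only [hm] at this
  exact (ENNReal.mul_right_inj two_ne_zero ENNReal.ofNat_ne_top).1 this

end Sphere

/-! ### Embeddings into `L_q` and representing measures -/

lemma integral_withDensity_ofReal {α : Type*} [MeasurableSpace α] (μ : Measure α) {f : α → ℝ}
    (hf : Measurable f) (g : α → ℝ) :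
    ∫ a, g a ∂(μ.withDensity fun a ↦ ENNReal.ofReal (f a)) = ∫ a, g a * max (f a) 0 ∂μ := by
  rw [integral_withDensity_eq_integral_toReal_smul (by fun_prop) (by simp)]
  simp [ENNReal.toReal_ofReal', mul_comm]

lemma MeasureTheory.Lp.coeFn_finset_sum {α ι : Type*} [MeasurableSpace α] {μ : Measure α}
    {E : Type*} [NormedAddCommGroup E] {p : ENNReal} (s : Finset ι) (f : ι → Lp E p μ) :
    ⇑(∑ i ∈ s, f i) =ᵐ[μ] fun a ↦ ∑ i ∈ s, f i a := by
  classical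
  induction s using Finset.induction_on with
  | empty => simpa using! Lp.coeFn_zero E p μ
  | insert i s hi ih =>
    rw [Finset.sum_insert hi]
    filter_upwards [Lp.coeFn_add (f i) (∑ i ∈ s, f i), ih] with a h1 h2
    rw [h1, Pi.add_apply, h2, Finset.sum_insert hi]

lemma toReal_eLpNorm_rpow {α : Type*} [MeasurableSpace α] {μ : Measure α} {E : Type*}
    [NormedAddCommGroup E] {q : ℝ} (hq : 0 < q) {f : α → E} (hf : MemLp f (ENNReal.ofReal q) μ) :
    (eLpNorm f (ENNReal.ofReal q) μ).toReal ^ q = ∫ a, ‖f a‖ ^ q ∂μ := by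
  have h0 : 0 ≤ ∫ a, ‖f a‖ ^ q ∂μ := integral_nonneg fun a ↦ by positivity
  rw [hf.eLpNorm_eq_integral_rpow_norm (by simpa using hq) ENNReal.ofReal_ne_top,
    ENNReal.toReal_ofReal hq.le, ENNReal.toReal_ofReal (by positivity), rpow_inv_rpow h0 hq.ne']

section

variable {n : ℕ} {X : Type*} [NormedAddCommGroup X] [NormedSpace ℝ X]
  (e : EuclideanSpace ℝ (Fin n) ≃ₗ[ℝ] X) {q : ℝ}

/-- The normalised measure is the law of some `φ` on `[0,1]`; the embedding sends `x` to `c ^ (1/q)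
⟪x, φ t⟫`, with `c` the total mass. -/
lemma isometricToSubspaceOfLq_of_measure (hq : 0 < q)
    (m : Measure (sphere (0 : EuclideanSpace ℝ (Fin n)) 1)) [IsFiniteMeasure m] (hm : m ≠ 0)
    (hrep : ∀ x, ‖e x‖ ^ q = ∫ ξ, |⟪x, (ξ : EuclideanSpace ℝ (Fin n))⟫| ^ q ∂m) :
    IsometricToSubspaceOfLq X q := by
  have : NeZero m := ⟨hm⟩
  obtain ⟨ξ₀⟩ := m.nonempty_of_neZero
  have : Nonempty (sphere (0 : EuclideanSpace ℝ (Fin n)) 1) := ⟨ξ₀⟩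
  have : StandardBorelSpace (sphere (0 : EuclideanSpace ℝ (Fin n)) 1) :=
    isClosed_sphere.measurableSet.standardBorel
  set c : ℝ := m.real Set.univ
  have hc : 0 < c := measureReal_univ_pos
  obtain ⟨φ, hφ, hmap⟩ := Measure.exists_measurable_map_eq ((m Set.univ)⁻¹ • m)
  have hmem (x : EuclideanSpace ℝ (Fin n)) :
      MemLp (fun t ↦ c ^ q⁻¹ * ⟪x, (φ t : EuclideanSpace ℝ (Fin n))⟫) (ENNReal.ofReal q)
        (volume : Measure unitInterval) := by
    refine MemLp.of_bound (by fun_prop) (c ^ q⁻¹ * ‖x‖) (ae_of_all _ fun t ↦ ?_)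
    rw [norm_mul, norm_of_nonneg (by positivity : 0 ≤ c ^ q⁻¹)]
    gcongr
    simpa using norm_inner_le_norm (𝕜 := ℝ) x (φ t : EuclideanSpace ℝ (Fin n))
  let T : EuclideanSpace ℝ (Fin n) →ₗ[ℝ]
      Lp ℝ (ENNReal.ofReal q) (volume : Measure unitInterval) :=
    { toFun x := (hmem x).toLp
      map_add' x y := by
        rw [← MemLp.toLp_add (hmem x) (hmem y)]
        exact MemLp.toLp_congr _ ((hmem x).add (hmem y)) (ae_of_all _ fun t ↦ by
          simp [inner_add_left, mul_add])
      map_smul' a x := by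
        rw [RingHom.id_apply, ← MemLp.toLp_const_smul a (hmem x)]
        exact MemLp.toLp_congr _ ((hmem x).const_smul a) (ae_of_all _ fun t ↦ by
          simp [real_inner_smul_left, mul_left_comm]) }
  refine ⟨T ∘ₗ e.symm.toLinearMap, fun x ↦ ?_⟩
  obtain ⟨y, rfl⟩ := e.surjective x
  have hT : ‖T y‖ = (eLpNorm (fun t ↦ c ^ q⁻¹ * ⟪y, (φ t : EuclideanSpace ℝ (Fin n))⟫)
      (ENNReal.ofReal q) volume).toReal := Lp.norm_toLp _ (hmem y)
  have hint : ∫ t, |⟪y, (φ t : EuclideanSpace ℝ (Fin n))⟫| ^ q =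
      ∫ ξ, |⟪y, (ξ : EuclideanSpace ℝ (Fin n))⟫| ^ q ∂((m Set.univ)⁻¹ • m) := by
    rw [← hmap, integral_map hφ.aemeasurable (by fun_prop : Measurable _).aestronglyMeasurable]
  simp only [LinearMap.comp_apply, LinearEquiv.coe_coe, LinearEquiv.symm_apply_apply]
  rw [hT]
  refine (rpow_left_inj ENNReal.toReal_nonneg (norm_nonneg _) hq.ne').1 ?_
  rw [toReal_eLpNorm_rpow hq (hmem y), hrep y]
  simp_rw [norm_mul, norm_of_nonneg (by positivity : 0 ≤ c ^ q⁻¹), Real.norm_eq_abs,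
    mul_rpow (by positivity : 0 ≤ c ^ q⁻¹) (abs_nonneg _), rpow_inv_rpow hc.le hq.ne']
  rw [integral_const_mul, hint, integral_smul_measure, ENNReal.toReal_inv, smul_eq_mul,
    ← mul_assoc, ← Measure.real, mul_inv_cancel₀ hc.ne', one_mul]

/-- Polar coordinates: by homogeneity, `‖F‖ ^ q` becomes a density and the direction of `F` is
pushed to the sphere. Where `F = 0` the direction `ξ₀` is arbitrary, as the density vanishes. -/
lemma exists_measure_sphere_of_integral_eq [Nonempty (sphere (0 : EuclideanSpace ℝ (Fin n)) 1)]
    (hq : 0 < q) {α : Type*} [MeasurableSpace α] {μ : Measure α}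
    {F : α → EuclideanSpace ℝ (Fin n)} (hF : Measurable F)
    (hint : Integrable (fun a ↦ ‖F a‖ ^ q) μ) :
    ∃ m : Measure (sphere (0 : EuclideanSpace ℝ (Fin n)) 1), IsFiniteMeasure m ∧
      ∀ x, ∫ ξ, |⟪x, (ξ : EuclideanSpace ℝ (Fin n))⟫| ^ q ∂m = ∫ a, |⟪x, F a⟫| ^ q ∂μ := by
  classical
  obtain ⟨ξ₀⟩ := ‹Nonempty (sphere (0 : EuclideanSpace ℝ (Fin n)) 1)›
  let N : EuclideanSpace ℝ (Fin n) → sphere (0 : EuclideanSpace ℝ (Fin n)) 1 := fun v ↦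
    ⟨if v = 0 then ξ₀ else ‖v‖⁻¹ • v, by
      split_ifs with hv
      · exact ξ₀.2
      · simp [norm_smul, hv]⟩
  have hN : Measurable N :=
    (Measurable.ite (measurableSet_singleton 0) measurable_const (by fun_prop)).subtype_mk
  have hnorm : Measurable fun a ↦ ‖F a‖ ^ q := by fun_prop
  have hfin : IsFiniteMeasure (μ.withDensity fun a ↦ ENNReal.ofReal (‖F a‖ ^ q)) :=
    isFiniteMeasure_withDensity_ofReal hint.2
  refine ⟨(μ.withDensity fun a ↦ ENNReal.ofReal (‖F a‖ ^ q)).map (N ∘ F),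
    Measure.isFiniteMeasure_map _ _, fun x ↦ ?_⟩
  rw [integral_map (hN.comp hF).aemeasurable (by fun_prop : Measurable _).aestronglyMeasurable,
    integral_withDensity_ofReal _ hnorm]
  refine integral_congr_ae (ae_of_all _ fun a ↦ ?_)
  by_cases ha : F a = 0
  · simp [ha, zero_rpow hq.ne']
  · have h0 : 0 < ‖F a‖ := norm_pos_iff.2 ha
    simp only [Function.comp, N, if_neg ha, real_inner_smul_right, abs_mul, abs_inv, abs_norm]
    rw [max_eq_left (by positivity), ← mul_rpow (by positivity) (by positivity), mul_right_comm,
      inv_mul_cancel₀ h0.ne', one_mul]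

lemma exists_measure_of_isometricToSubspaceOfLq
    [Nonempty (sphere (0 : EuclideanSpace ℝ (Fin n)) 1)] (hq : 0 < q)
    (h : IsometricToSubspaceOfLq X q) :
    ∃ m : Measure (sphere (0 : EuclideanSpace ℝ (Fin n)) 1), IsFiniteMeasure m ∧
      ∀ x, ‖e x‖ ^ q = ∫ ξ, |⟪x, (ξ : EuclideanSpace ℝ (Fin n))⟫| ^ q ∂m := by
  obtain ⟨T, hT⟩ := h
  -- By linearity `T (e x)` is almost everywhere `⟪x, F t⟫`, where `F` collects the images of the
  -- basis vectors.
  let f (i : Fin n) := T (e (EuclideanSpace.single i 1))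
  let F : unitInterval → EuclideanSpace ℝ (Fin n) := fun t ↦ WithLp.toLp 2 fun i ↦ f i t
  have hf (i : Fin n) : Measurable (f i) := (Lp.stronglyMeasurable (f i)).measurable
  have hF : Measurable F := by fun_prop
  have hmem : MemLp F (ENNReal.ofReal q) volume := memLp_piLp_iff.2 fun i ↦ Lp.memLp (f i)
  have hint : Integrable (fun t ↦ ‖F t‖ ^ q) volume := by
    simpa [ENNReal.toReal_ofReal hq.le] using
      hmem.integrable_norm_rpow (by simpa using hq) ENNReal.ofReal_ne_top
  obtain ⟨m, hm, hrep⟩ := exists_measure_sphere_of_integral_eq hq hF hint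
  refine ⟨m, hm, fun x ↦ ?_⟩
  rw [hrep, ← hT, Lp.norm_def, toReal_eLpNorm_rpow hq (Lp.memLp _)]
  refine integral_congr_ae ?_
  have hx : T (e x) = ∑ i, x i • f i := by
    conv_lhs => rw [← (EuclideanSpace.basisFun (Fin n) ℝ).sum_repr x]
    simp [f]
  have hs : ∀ᵐ t, ∀ i, (x i • f i) t = x i * f i t :=
    ae_all_iff.2 fun i ↦ by
      filter_upwards [Lp.coeFn_smul (x i) (f i)] with t ht
      simpa using ht
  rw [hx]
  filter_upwards [hs, Lp.coeFn_finset_sum Finset.univ fun i ↦ x i • f i] with t h1 h2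
  rw [h2]
  simp [h1, F, PiLp.inner_apply, mul_comm]

end

/-! ### The characterisation -/

theorem proposition1 (q : ℝ) (hq : 0 < q) (hq_even : ∀ m : ℤ, Even m → q ≠ (m : ℝ))
    (n : ℕ) (hn : 1 ≤ n)
    (X : Type*) [NormedAddCommGroup X] [NormedSpace ℝ X]
    (e : EuclideanSpace ℝ (Fin n) ≃ₗ[ℝ] X)
    (b : sphere (0 : EuclideanSpace ℝ (Fin n)) 1 → ℝ) (hb : Continuous b)
    (hrep : ∀ x : EuclideanSpace ℝ (Fin n),
      ‖e x‖ ^ q = ∫ ξ : sphere (0 : EuclideanSpace ℝ (Fin n)) 1,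
        |inner ℝ x (ξ : EuclideanSpace ℝ (Fin n))| ^ q * b ξ
          ∂((volume : Measure (EuclideanSpace ℝ (Fin n))).toSphere)) :
    (((∀ ξ, 0 ≤ b ξ) ∧ (∃ ξ, b ξ ≠ 0)) → IsometricToSubspaceOfLq X q) ∧
    ((∀ ξ, b (-ξ) = b ξ) →
      (IsometricToSubspaceOfLq X q ↔ (∀ ξ, 0 ≤ b ξ) ∧ (∃ ξ, b ξ ≠ 0))) := by
  set σ := (volume : Measure (EuclideanSpace ℝ (Fin n))).toSphere
  let x₀ : EuclideanSpace ℝ (Fin n) := EuclideanSpace.single ⟨0, hn⟩ 1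
  have hx₀ : 0 < ‖e x₀‖ ^ q := by
    have : e x₀ ≠ 0 := by simp [x₀]
    positivity
  have : Nonempty (sphere (0 : EuclideanSpace ℝ (Fin n)) 1) := ⟨⟨x₀, by simp [x₀]⟩⟩
  have hfin {f : sphere (0 : EuclideanSpace ℝ (Fin n)) 1 → ℝ} (hf : Continuous f) :
      IsFiniteMeasure (σ.withDensity fun ξ ↦ ENNReal.ofReal (f ξ)) :=
    isFiniteMeasure_withDensity_ofReal hf.integrable_of_compactSpace.2
  have hfin1 := hfin hb
  have hfin2 := hfin hb.neg
  have hcont (x : EuclideanSpace ℝ (Fin n)) :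
      Continuous fun ξ : sphere (0 : EuclideanSpace ℝ (Fin n)) 1 ↦
        |⟪x, (ξ : EuclideanSpace ℝ (Fin n))⟫| ^ q :=
    Continuous.rpow_const (by fun_prop) fun _ ↦ Or.inr hq.le
  have suff : ((∀ ξ, 0 ≤ b ξ) ∧ (∃ ξ, b ξ ≠ 0)) → IsometricToSubspaceOfLq X q := by
    rintro ⟨hb0, -⟩
    have hrep' (x : EuclideanSpace ℝ (Fin n)) :
        ‖e x‖ ^ q = ∫ ξ, |⟪x, (ξ : EuclideanSpace ℝ (Fin n))⟫| ^ q
          ∂(σ.withDensity fun ξ ↦ ENNReal.ofReal (b ξ)) := by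
      simp_rw [hrep x, integral_withDensity_ofReal σ hb.measurable, max_eq_left (hb0 _)]
    refine isometricToSubspaceOfLq_of_measure e hq _ (fun h0 ↦ ?_) hrep'
    have := hrep' x₀
    simp only [h0, integral_zero_measure] at this
    exact hx₀.ne' this
  refine ⟨suff, fun heven ↦ ⟨fun h ↦ ⟨?_, ?_⟩, suff⟩⟩
  · by_contra! hneg
    obtain ⟨m, hm, hmrep⟩ := exists_measure_of_isometricToSubspaceOfLq e hq h
    have hU : IsOpen {ξ | b ξ < 0} := isOpen_lt hb continuous_const
    -- Moving `b⁻` to the other side keeps both measures positive. On `{b < 0}` the first is null,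
    -- hence so is `b⁻σ`; but `b⁻ > 0` there and `σ` charges nonempty open sets.
    have key := measure_eq_of_integral_abs_inner_rpow_eq
      (m := σ.withDensity fun ξ ↦ ENNReal.ofReal (b ξ))
      (m' := m + σ.withDensity fun ξ ↦ ENNReal.ofReal (-b ξ)) hq hq_even (fun x ↦ ?_)
      hU.measurableSet (by simp [heven])
    · have h1 : σ.withDensity (fun ξ ↦ ENNReal.ofReal (b ξ)) {ξ | b ξ < 0} = 0 := by
        rw [withDensity_apply_eq_zero (by fun_prop)]
        convert measure_empty (μ := σ)
        ext ξ
        simpa using fun h ↦ h.le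
      rw [h1, Measure.add_apply, eq_comm, add_eq_zero, withDensity_apply_eq_zero (by fun_prop)]
        at key
      refine hU.measure_ne_zero σ hneg (measure_mono_null (fun ξ hξ ↦ ?_) key.2)
      simpa using hξ
    · rw [integral_add_measure (hcont x).integrable_of_compactSpace
        (hcont x).integrable_of_compactSpace, ← hmrep, hrep,
        integral_withDensity_ofReal σ hb.measurable,
        integral_withDensity_ofReal σ (f := fun ξ ↦ -b ξ) hb.neg.measurable,
        ← integral_add (Continuous.integrable_of_compactSpace (by have := hcont x; fun_prop))
          (Continuous.integrable_of_compactSpace (by have := hcont x; fun_prop))]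
      refine integral_congr_ae (ae_of_all _ fun ξ ↦ ?_)
      simp only [← mul_add]
      congr 1
      rcases le_total 0 (b ξ) with h | h <;> simp [h]
  · by_contra! hzero
    have := hrep x₀
    simp only [hzero, mul_zero, integral_zero] at this
    exact hx₀.ne' this
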